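/- Let $(\mathbb{E},\circ,\bullet)$ be a Euclidean Jordan algebra of dimension $n$: a finite-dimensional real vector space with a bilinear product satisfying $x\circ y=y\circ x$ and $x\circ((x\circ x)\circ y)=(x\circ x)\circ(x\circ y)$, an identity element $e$, and a fixed inner product with $(x\circ y)\bullet z=x\bullet(y\circ z)$. Let $\mathrm{rk}$ be its rank (the maximal degree of the minimal polynomial of an element), and let $\mathbb{E}_+=\{x\circ x\mid x\in\mathbb{E}\}$ be its symmetric cone. Let $\mathfrak{F}(\mathbb{E})$ be the set of ordered Jordan frames, i.e. of tuples $(c_1,\dots,c_{\mathrm{rk}})$ of primitive idempotents with $c_i\circ c_j=0$ for $i\ne j$ and $\sum_i c_i=e$; an idempotent is primitive if it is nonzero and not the sum of two nonzero idempotents. The symmetric group $\mathfrak{S}_{\mathrm{rk}}$ acts on $\mathfrak{F}(\mathbb{E})$ by permuting the entries. Let $\mathfrak{F}_{\mathrm c}(\mathbb{E})$ be a complete set of representatives of the orbits, and fix a set $\mathfrak{F}$ with $\mathfrak{F}_{\mathrm c}(\mathbb{E})\subseteq\mathfrak{F}\subseteq\mathfrak{F}(\mathbb{E})$. Let $m$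 be a nonnegative integer. For a finite-dimensional real inner product space $\mathbb{V}$ of dimension $d$, let $\mathcal{S}^{d,m}(\mathbb{V})\subseteq\mathbb{V}^{\otimes m}$ be the space of symmetric tensors of order $m$, with the inner product determined by $\langle x_1\otimes\cdots\otimes x_m,\,y_1\otimes\cdots\otimes y_m\rangle=\prod_k (x_k,y_k)$. For $\mathbb{K}\subseteq\mathbb{V}$ let $$\mathcal{COP}^{d,m}(\mathbb{K})=\{\mathcal{A}\in\mathcal{S}^{d,m}(\mathbb{V})\mid\langle\mathcal{A},x^{\otimes m}\rangle\ge0\text{ for all }x\in\mathbb{K}\}.$$ Write $\mathcal{S}^{k,m}=\mathcal{S}^{k,m}(\mathbb{R}^k)$ and $\mathcal{COP}^{k,m}=\mathcal{COP}^{k,m}(\mathbb{R}^k_+)$. For $\mathcal{A}\in\mathcal{S}^{n,m}(\mathbb{E})$ and $(c_1,\dots,c_{\mathrm{rk}})\in\mathfrak{F}(\mathbb{E})$, let $\mathcal{A}(c_1,\dots,c_{\mathrm{rk}})\in\mathcal{S}^{\mathrm{rk},m}$ be the symmetric tensor whose $(i_1,\dots,i_m)$th entry is $\langle\mathcal{A},c_{i_1}\otimes\cdots\otimes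 c_{i_m}\rangle$. A cone is a nonempty set closed under multiplication by positive scalars. Let $(\mathcal{O}_r^{\mathrm{rk},m})_{r\in\mathbb{N}}$ be a sequence of closed convex cones in $\mathcal{S}^{\mathrm{rk},m}$ such that $\mathcal{O}_{r+1}^{\mathrm{rk},m}\subseteq\mathcal{O}_r^{\mathrm{rk},m}$ for all $r\in\mathbb{N}$ and $\mathcal{COP}^{\mathrm{rk},m}=\bigcap_{r=0}^\infty\mathcal{O}_r^{\mathrm{rk},m}$. For $r\in\mathbb{N}$ let $$\mathcal{O}_r^{n,m}(\mathbb{E}_+)=\bigcap_{(c_1,\dots,c_{\mathrm{rk}})\in\mathfrak{F}}\{\mathcal{A}\in\mathcal{S}^{n,m}(\mathbb{E})\mid\mathcal{A}(c_1,\dots,c_{\mathrm{rk}})\in\mathcal{O}_r^{\mathrm{rk},m}\}.$$ Then each $\mathcal{O}_r^{n,m}(\mathbb{E}_+)$ is a closed convex cone, $\mathcal{O}_{r+1}^{n,m}(\mathbb{E}_+)\subseteq\mathcal{O}_r^{n,m}(\mathbb{E}_+)$ for all $r\in\mathbb{N}$, and $\mathcal{COP}^{n,m}(\mathbb{E}_+)=\bigcap_{r=0}^\infty\mathcal{O}_r^{n,m}(\mathbb{E}_+)$.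 -/

import Mathlib

open scoped TensorProduct

noncomputable section

/-! ### Tensor powers of a finite-dimensional real inner product space -/

/-- The tensor space `V ⊗ ⋯ ⊗ V` with `m` factors. It is a copy of Mathlib's tensor power, made a
type of its own so that it can carry the norm of the induced inner product (and not the
projective norm). -/
def TensorPow (V : Type*) [AddCommGroup V] [Module ℝ V] (m : ℕ) : Type _ :=
  ⨂[ℝ] _ : Fin m, V

namespace TensorPow

section Algebra

variable {V : Type*} [AddCommGroup V] [Module ℝ V] {m : ℕ}

instance : AddCommGroup (TensorPow V m) :=
  inferInstanceAs (AddCommGroup (⨂[ℝ] _ : Fin m, V))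

instance : Module ℝ (TensorPow V m) :=
  inferInstanceAs (Module ℝ (⨂[ℝ] _ : Fin m, V))

instance [FiniteDimensional ℝ V] : FiniteDimensional ℝ (TensorPow V m) :=
  inferInstanceAs (Module.Finite ℝ (⨂[ℝ] _ : Fin m, V))

/-- The pure tensor `x 0 ⊗ ⋯ ⊗ x (m - 1)`. -/
def pure (x : Fin m → V) : TensorPow V m :=
  PiTensorProduct.tprod ℝ x

/-- The linear map `π_σ` with `π_σ (x 0 ⊗ ⋯ ⊗ x (m - 1)) = x (σ 0) ⊗ ⋯ ⊗ x (σ (m - 1))`. -/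
def perm (σ : Equiv.Perm (Fin m)) : TensorPow V m →ₗ[ℝ] TensorPow V m :=
  PiTensorProduct.lift
    ((PiTensorProduct.tprod ℝ : MultilinearMap ℝ (fun _ : Fin m => V) _).domDomCongr σ)

theorem perm_pure (σ : Equiv.Perm (Fin m)) (x : Fin m → V) :
    perm σ (pure x) = pure (fun k => x (σ k)) := by
  unfold perm pure
  exact PiTensorProduct.lift.tprod x

theorem linearMap_ext {W : Type*} [AddCommGroup W] [Module ℝ W]
    {f g : TensorPow V m →ₗ[ℝ] W} (h : ∀ x : Fin m → V, f (pure x) = g (pure x)) : f = g := by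
  refine PiTensorProduct.ext (R := ℝ) (s := fun _ : Fin m => V) ?_
  ext x
  exact h x

end Algebra

section Inner

variable {V : Type*} [NormedAddCommGroup V] [InnerProductSpace ℝ V] {m : ℕ}

/-- The induced inner product as a bilinear map. -/
def innerBilin (V : Type*) [NormedAddCommGroup V] [InnerProductSpace ℝ V] (m : ℕ) :
    TensorPow V m →ₗ[ℝ] TensorPow V m →ₗ[ℝ] ℝ :=
  (PiTensorProduct.dualDistrib (R := ℝ) (M := fun _ : Fin m => V)) ∘ₗ
    PiTensorProduct.map (fun _ : Fin m => innerₗ V)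

theorem innerBilin_pure (x y : Fin m → V) :
    innerBilin V m (pure x) (pure y) = ∏ k, inner ℝ (x k) (y k) := by
  have h : PiTensorProduct.map (fun _ : Fin m => innerₗ V) (PiTensorProduct.tprod ℝ x) =
      PiTensorProduct.tprod ℝ (fun k => innerₗ V (x k)) :=
    PiTensorProduct.map_tprod (fun _ : Fin m => innerₗ V) x
  have h' := PiTensorProduct.dualDistrib_apply (R := ℝ) (M := fun _ : Fin m => V)
    (fun k => innerₗ V (x k)) y
  rw [← h] at h'
  exact h'

variable [FiniteDimensional ℝ V]

/-- Coordinates with respect to the products of the vectors of an orthonormal basis. -/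
def coord (V : Type*) [NormedAddCommGroup V] [InnerProductSpace ℝ V] [FiniteDimensional ℝ V]
    (m : ℕ) : Module.Basis (Fin m → Fin (Module.finrank ℝ V)) ℝ (TensorPow V m) :=
  Basis.piTensorProduct (fun _ : Fin m => (stdOrthonormalBasis ℝ V).toBasis)

theorem coord_apply (p : Fin m → Fin (Module.finrank ℝ V)) :
    coord V m p = pure (fun k => stdOrthonormalBasis ℝ V (p k)) := by
  have h := Basis.piTensorProduct_apply (R := ℝ)
    (fun _ : Fin m => (stdOrthonormalBasis ℝ V).toBasis) p
  simp only [OrthonormalBasis.coe_toBasis] at h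
  exact h

theorem innerBilin_eq_sum (A B : TensorPow V m) :
    innerBilin V m A B = ∑ p, (coord V m).repr A p * (coord V m).repr B p := by
  classical
  have key : ∀ p q, innerBilin V m (coord V m p) (coord V m q) = if p = q then 1 else 0 := by
    intro p q
    rw [coord_apply, coord_apply, innerBilin_pure]
    simp only [OrthonormalBasis.inner_eq_ite, Fintype.prod_ite_zero, Finset.prod_const_one,
      ← funext_iff]
  have h : ∀ p, innerBilin V m (coord V m p) B = (coord V m).repr B p := by
    intro p
    conv_lhs => rw [← (coord V m).sum_repr B]
    rw [map_sum]
    simp only [map_smul, key, smul_eq_mul, mul_ite, mul_one, mul_zero, Finset.sum_ite_eq,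
      Finset.mem_univ, if_true]
  conv_lhs => rw [← (coord V m).sum_repr A]
  rw [map_sum, LinearMap.sum_apply]
  simp only [map_smul, LinearMap.smul_apply, h, smul_eq_mul]

/-- The induced inner product is an inner product. -/
@[reducible]
def innerCore (V : Type*) [NormedAddCommGroup V] [InnerProductSpace ℝ V]
    [FiniteDimensional ℝ V] (m : ℕ) : InnerProductSpace.Core ℝ (TensorPow V m) where
  inner A B := innerBilin V m A B
  conj_inner_symm A B := by
    simp only [innerBilin_eq_sum, conj_trivial]
    exact Finset.sum_congr rfl fun p _ => mul_comm _ _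
  re_inner_nonneg A := by
    simp only [innerBilin_eq_sum, RCLike.re_to_real]
    exact Finset.sum_nonneg fun p _ => mul_self_nonneg _
  add_left A B C := by simp
  smul_left A B r := by simp
  definite A h := by
    replace h : innerBilin V m A A = 0 := h
    rw [innerBilin_eq_sum, Finset.sum_eq_zero_iff_of_nonneg fun p _ => mul_self_nonneg _] at h
    refine (coord V m).ext_elem fun p => ?_
    simpa using h p (Finset.mem_univ p)

instance : NormedAddCommGroup (TensorPow V m) :=
  (innerCore V m).toNormedAddCommGroup

instance : InnerProductSpace ℝ (TensorPow V m) :=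
  InnerProductSpace.ofCore (innerCore V m).toCore

theorem inner_eq (A B : TensorPow V m) : inner ℝ A B = innerBilin V m A B := rfl

theorem inner_pure (x y : Fin m → V) :
    inner ℝ (pure x) (pure y) = ∏ k, inner ℝ (x k) (y k) :=
  innerBilin_pure x y

theorem inner_perm (σ : Equiv.Perm (Fin m)) (A B : TensorPow V m) :
    inner ℝ (perm σ A) (perm σ B) = inner ℝ A B := by
  have h : (innerBilin V m).compl₁₂ (perm σ) (perm σ) = innerBilin V m := by
    refine linearMap_ext fun x => linearMap_ext fun y => ?_
    simp only [LinearMap.compl₁₂_apply, perm_pure, innerBilin_pure]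
    exact Equiv.prod_comp σ fun k => inner ℝ (x k) (y k)
  exact LinearMap.congr_fun (LinearMap.congr_fun h A) B

end Inner

end TensorPow

/-! ### Symmetric tensors and copositive cones -/

/-- The space of symmetric tensors of order `m` over `V`. -/
def symTensor (V : Type*) [NormedAddCommGroup V] [InnerProductSpace ℝ V]
    [FiniteDimensional ℝ V] (m : ℕ) : Submodule ℝ (TensorPow V m) where
  carrier := {A | ∀ σ : Equiv.Perm (Fin m), TensorPow.perm σ A = A}
  add_mem' hA hB σ := by rw [map_add, hA σ, hB σ]
  zero_mem' σ := map_zero _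
  smul_mem' r A hA σ := by rw [map_smul, hA σ]

/-- The copositive cone of order `m` over `K`. -/
def copCone {V : Type*} [NormedAddCommGroup V] [InnerProductSpace ℝ V]
    [FiniteDimensional ℝ V] (m : ℕ) (K : Set V) : Set (symTensor V m) :=
  {A | ∀ x ∈ K, 0 ≤ inner ℝ (A : TensorPow V m) (TensorPow.pure fun _ => x)}

/-- The nonnegative orthant of `ℝⁿ`. -/
def nonnegOrthant (n : ℕ) : Set (EuclideanSpace ℝ (Fin n)) :=
  {x | ∀ i, 0 ≤ x i}

/-- A closed convex cone: a nonempty closed convex set that is stable under multiplication by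
positive scalars. -/
structure IsClosedConvexCone {X : Type*} [NormedAddCommGroup X] [NormedSpace ℝ X]
    (K : Set X) : Prop where
  nonempty : K.Nonempty
  smul_mem : ∀ α : ℝ, 0 < α → ∀ x ∈ K, α • x ∈ K
  convex : Convex ℝ K
  closed : IsClosed K

/-- A sequence of sets that decreases with intersection `L`. -/
def DecreasesTo {X : Type*} (K : ℕ → Set X) (L : Set X) : Prop :=
  (∀ r, K (r + 1) ⊆ K r) ∧ L = ⋂ r, K r

/-! ### Euclidean Jordan algebras -/

/-- The structure of a Euclidean Jordan algebra on the finite-dimensional real inner product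
space `E`: a bilinear product satisfying the Jordan identities, with an identity element, for
which the inner product of `E` is associative. -/
structure EuclideanJordanAlgebra (E : Type*) [NormedAddCommGroup E] [InnerProductSpace ℝ E]
    [FiniteDimensional ℝ E] where
  mul : E →ₗ[ℝ] E →ₗ[ℝ] E
  one : E
  mul_comm : ∀ x y, mul x y = mul y x
  jordan : ∀ x y, mul x (mul (mul x x) y) = mul (mul x x) (mul x y)
  one_mul : ∀ x, mul one x = x
  inner_mul : ∀ x y z, inner ℝ (mul x y) z = inner ℝ x (mul y z)

namespace EuclideanJordanAlgebra

variable {E : Type*} [NormedAddCommGroup E] [InnerProductSpace ℝ E] [FiniteDimensional ℝ E]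
  (J : EuclideanJordanAlgebra E)

/-- Powers: `x⁰ = e` and `xᵏ⁺¹ = x ∘ xᵏ`. -/
def pow (x : E) : ℕ → E
  | 0 => J.one
  | k + 1 => J.mul x (pow x k)

/-- The degree of the minimal polynomial of `x`: the least `k` for which `x⁰, …, xᵏ` are linearly
dependent. -/
def degree (x : E) : ℕ :=
  sInf {k | ¬ LinearIndependent ℝ (fun i : Fin (k + 1) => J.pow x i)}

/-- The rank: the maximal degree of the minimal polynomial of an element. -/
def rank : ℕ :=
  ⨆ x : E, J.degree x

/-- The symmetric cone, i.e. the set of squares. -/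
def symmetricCone : Set E :=
  {y | ∃ x, y = J.mul x x}

def IsIdempotent (c : E) : Prop :=
  J.mul c c = c

/-- A nonzero idempotent that is not the sum of two nonzero idempotents. -/
def IsPrimitive (c : E) : Prop :=
  J.IsIdempotent c ∧ c ≠ 0 ∧
    ¬ ∃ a b : E, J.IsIdempotent a ∧ J.IsIdempotent b ∧ a ≠ 0 ∧ b ≠ 0 ∧ c = a + b

/-- The set of ordered Jordan frames: complete systems of orthogonal primitive idempotents, with
as many members as the rank. -/
def frames : Set (Fin J.rank → E) :=
  {c | (∀ i, J.IsPrimitive (c i)) ∧ (∀ i j, i ≠ j → J.mul (c i) (c j) = 0) ∧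
    ∑ i, c i = J.one}

/-- `R` is a complete set of representatives of the orbits of the symmetric group acting on the
ordered Jordan frames by permuting their members. -/
def IsFrameTransversal (R : Set (Fin J.rank → E)) : Prop :=
  R ⊆ J.frames ∧
    ∀ c ∈ J.frames, ∃! d, d ∈ R ∧ ∃ σ : Equiv.Perm (Fin J.rank), d = fun i => c (σ i)

end EuclideanJordanAlgebra

/-! ### Evaluation of a symmetric tensor at a finite system of vectors -/

/-- For a symmetric tensor `A` over `E` and a system `c` of `k` vectors, the symmetric tensor
`A(c)` over `ℝᵏ` whose `(i₁, …, iₘ)` entry is `⟨A, c i₁ ⊗ ⋯ ⊗ c iₘ⟩`. -/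
def evalAt {E : Type*} [NormedAddCommGroup E] [InnerProductSpace ℝ E] [FiniteDimensional ℝ E]
    {m k : ℕ} (A : symTensor E m) (c : Fin k → E) : symTensor (EuclideanSpace ℝ (Fin k)) m :=
  ⟨∑ i : Fin m → Fin k,
      inner ℝ (A : TensorPow E m) (TensorPow.pure fun l => c (i l)) •
        TensorPow.pure fun l => EuclideanSpace.single (i l) (1 : ℝ), by
    intro σ
    rw [map_sum, ← Equiv.sum_comp (Equiv.arrowCongr σ (Equiv.refl (Fin k)))]
    refine Finset.sum_congr rfl fun i _ => ?_
    rw [map_smul, TensorPow.perm_pure]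
    congr 1
    · rw [← TensorPow.inner_perm σ, A.2 σ, TensorPow.perm_pure]
      simp [Equiv.arrowCongr]
    · simp [Equiv.arrowCongr]⟩

/-- The set of symmetric tensors `A` over `E` with `A(c) ∈ K` for all frames `c ∈ F`. -/
def frameCone {E : Type*} [NormedAddCommGroup E] [InnerProductSpace ℝ E]
    [FiniteDimensional ℝ E] {m k : ℕ} (F : Set (Fin k → E))
    (K : Set (symTensor (EuclideanSpace ℝ (Fin k)) m)) : Set (symTensor E m) :=
  ⋂ c ∈ F, {A | evalAt A c ∈ K}

end

/-! ### Operator identities and power associativity -/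

namespace EuclideanJordanAlgebra

variable {E : Type*} [NormedAddCommGroup E] [InnerProductSpace ℝ E] [FiniteDimensional ℝ E]
  (J : EuclideanJordanAlgebra E)

/-! By multilinearity `⟨A(c), x^{⊗m}⟩ = ⟨A, (∑ xⱼ cⱼ)^{⊗m}⟩` (`inner_evalAt`), so copositivity of
all `A(c)` says that `A` is nonnegative on nonnegative combinations of frames. These are exactly the
squares: if `y = ∑ aᵢ cᵢ`, then `y ∘ y = ∑ aᵢ² cᵢ`. Permuting a frame only permutes coordinates, so
orbit representatives suffice (`copCone_symmetricCone`). As `A ↦ A(c)` is linear, pulling back along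
it preserves closed convex cones and intersections.

The substance is the spectral theorem with frames of exactly `rk` primitive idempotents.
Diagonalizing multiplication by `x` writes `x` through orthogonal idempotents (`exists_spectral`),
possibly fewer than `rk`. If `e, x, …, x^{rk-1}` are independent there are exactly `rk`, and such a
system is a frame since no system has more than `rk` members (`IsOrthogonalSystem.card_le_rank`).
Such `x` are dense, and the combinations of systems of `rk` idempotents form a closed set, so every
element is reached. -/

theorem mul_one (x : E) : J.mul x J.one = x := by
  rw [J.mul_comm, J.one_mul]

theorem isSymmetric_mul (x : E) : (J.mul x).IsSymmetric := fun y z => by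
  rw [J.mul_comm x y, J.inner_mul]

/-- The Jordan identity, linearized once. -/
theorem jordan_linearized (x y z : E) :
    J.mul (J.mul (J.mul x x) y) z + (2 : ℝ) • J.mul x (J.mul y (J.mul x z)) =
      J.mul (J.mul x x) (J.mul y z) + (2 : ℝ) • J.mul (J.mul x y) (J.mul x z) := by
  -- The identity is cubic in its first argument; half the sum of its values at `z + x` and `z - x`,
  -- minus its value at `z`, isolates the part quadratic in `x` and linear in `z`.
  have h1 := J.jordan (z + x) y
  have h2 := J.jordan (z - x) y
  have h3 := J.jordan z y
  rw [J.mul_comm _ z, J.mul_comm y (J.mul x z), J.mul_comm y z, J.mul_comm (J.mul x y)]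
  simp only [map_add, map_sub, LinearMap.add_apply, LinearMap.sub_apply, J.mul_comm z x]
    at h1 h2 h3
  linear_combination (norm := module) (1 / 2 : ℝ) • h1 + (1 / 2 : ℝ) • h2 - h3

theorem pow_eq (x : E) (n : ℕ) : J.pow x n = (J.mul x ^ n) J.one := by
  induction n with
  | zero => rfl
  | succ n ih => rw [pow_succ', Module.End.mul_apply, ← ih]; rfl

theorem pow_zero (x : E) : J.pow x 0 = J.one := rfl

theorem pow_succ (x : E) (n : ℕ) : J.pow x (n + 1) = J.mul x (J.pow x n) := rfl

theorem commute_mul_sq (x : E) : Commute (J.mul (J.mul x x)) (J.mul x) :=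
  LinearMap.ext fun y => (J.jordan x y).symm

theorem sq_mul_pow (x : E) (n : ℕ) : J.mul (J.mul x x) (J.pow x n) = J.pow x (n + 2) := by
  have h := LinearMap.congr_fun ((J.commute_mul_sq x).pow_right n) J.one
  simp only [Module.End.mul_apply, J.mul_one] at h
  rw [pow_eq, h, pow_eq, _root_.pow_add, Module.End.mul_apply, pow_two, Module.End.mul_apply, J.mul_one]

/-- The linearized identity at `y = xⁿ`, read as an operator identity in `z`. -/
theorem mul_pow_add_two (x : E) (n : ℕ) :
    J.mul (J.pow x (n + 2)) = J.mul (J.mul x x) * J.mul (J.pow x n)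
      + (2 : ℝ) • (J.mul (J.pow x (n + 1)) * J.mul x)
      - (2 : ℝ) • (J.mul x * J.mul (J.pow x n) * J.mul x) := by
  refine LinearMap.ext fun z => ?_
  have h := J.jordan_linearized x (J.pow x n) z
  rw [sq_mul_pow, ← pow_succ] at h
  simp only [LinearMap.sub_apply, LinearMap.add_apply, LinearMap.smul_apply,
    Module.End.mul_apply]
  linear_combination (norm := module) h

/-- The recursion `mul_pow_add_two` has order two and involves both `L_x` and `L_{x∘x}`, so the
induction carries two consecutive powers and both commutation relations. -/
theorem commute_mul_pow (x : E) (n : ℕ) :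
    (Commute (J.mul (J.pow x n)) (J.mul x) ∧
      Commute (J.mul (J.pow x n)) (J.mul (J.mul x x))) ∧
    (Commute (J.mul (J.pow x (n + 1))) (J.mul x) ∧
      Commute (J.mul (J.pow x (n + 1))) (J.mul (J.mul x x))) := by
  have hx := J.commute_mul_sq x
  induction n with
  | zero =>
    have h1 : J.mul J.one = 1 := LinearMap.ext J.one_mul
    simp only [pow_zero, pow_succ, J.mul_one, h1]
    exact ⟨⟨Commute.one_left _, Commute.one_left _⟩, Commute.refl _, hx.symm⟩
  | succ n ih =>
    obtain ⟨⟨h1, h2⟩, h3, h4⟩ := ih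
    refine ⟨⟨h3, h4⟩, ?_, ?_⟩
    · rw [mul_pow_add_two]
      exact ((hx.mul_left h1).add_left ((h3.mul_left (Commute.refl _)).smul_left 2)).sub_left
        ((((Commute.refl _).mul_left h1).mul_left (Commute.refl _)).smul_left 2)
    · rw [mul_pow_add_two]
      exact (((Commute.refl _).mul_left h2).add_left ((h4.mul_left hx.symm).smul_left 2)).sub_left
        (((hx.symm.mul_left h2).mul_left hx.symm).smul_left 2)

/-- Euclidean Jordan algebras are power associative. -/
theorem pow_add (x : E) (i j : ℕ) : J.mul (J.pow x i) (J.pow x j) = J.pow x (i + j) := by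
  induction j with
  | zero => exact J.mul_one _
  | succ j ih =>
    rw [pow_succ, ← Module.End.mul_apply, (J.commute_mul_pow x i).1.1.eq, Module.End.mul_apply, ih]
    rfl

open Polynomial in
-- Power associativity extended bilinearly: `p ↦ p(L_x) e` is multiplicative.
theorem mul_aeval (x : E) (p q : ℝ[X]) :
    J.mul (aeval (J.mul x) p J.one) (aeval (J.mul x) q J.one) =
      aeval (J.mul x) (p * q) J.one := by
  induction p using Polynomial.induction_on' with
  | add p p' hp hp' => simp only [add_mul, map_add, LinearMap.add_apply, hp, hp']
  | monomial i a =>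
    induction q using Polynomial.induction_on' with
    | add q q' hq hq' => simp only [mul_add, map_add, LinearMap.add_apply, hq, hq']
    | monomial j b =>
      simp only [monomial_mul_monomial, aeval_monomial, Module.End.mul_apply,
        Module.algebraMap_end_apply, ← pow_eq, map_smul, LinearMap.smul_apply, pow_add, smul_smul,
        _root_.mul_comm b]

/-! ### Systems of orthogonal idempotents -/

/-- A complete system of nonzero orthogonal idempotents. -/
structure IsOrthogonalSystem {ι : Type*} [Fintype ι] (c : ι → E) : Prop where
  idem : ∀ i, J.IsIdempotent (c i)
  ne_zero : ∀ i, c i ≠ 0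
  ortho : ∀ i j, i ≠ j → J.mul (c i) (c j) = 0
  sum : ∑ i, c i = J.one

open Polynomial in
/-- The spectral theorem for a single element. -/
theorem exists_spectral (x : E) : ∃ (s : Finset ℝ) (c : s → E), J.IsOrthogonalSystem c ∧
    ∀ p : ℝ[X], aeval (J.mul x) p J.one = ∑ i : s, p.eval (i : ℝ) • c i := by
  classical
  have hT := J.isSymmetric_mul x
  set n := Module.finrank ℝ E with hn
  let b := hT.eigenvectorBasis hn.symm
  let l := hT.eigenvalues hn.symm
  -- The component of `e` in the `t`-eigenspace of `L_x`.
  let d : ℝ → E := fun t => ∑ i with l i = t, b.repr J.one i • b i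
  have hd : ∀ p : ℝ[X], aeval (J.mul x) p J.one =
      ∑ t ∈ Finset.univ.image l, p.eval t • d t := by
    intro p
    conv_lhs => rw [← b.sum_repr J.one]
    rw [map_sum, ← Finset.sum_fiberwise_of_maps_to (g := l) (t := Finset.univ.image l)
      (fun i _ => Finset.mem_image_of_mem l (Finset.mem_univ i))]
    refine Finset.sum_congr rfl fun t _ => ?_
    rw [Finset.smul_sum]
    refine Finset.sum_congr rfl fun i hi => ?_
    rw [map_smul, Module.End.aeval_apply_of_mem_apply_eq_smul (hT.apply_eigenvectorBasis hn.symm i),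
      smul_comm]
    rw [← (Finset.mem_filter.mp hi).2]
    rfl
  let s := (Finset.univ.image l).filter fun t => d t ≠ 0
  have hs : ∀ p : ℝ[X], aeval (J.mul x) p J.one = ∑ i : s, p.eval (i : ℝ) • d i := by
    intro p
    rw [hd, Finset.sum_coe_sort s fun t => p.eval t • d t, Finset.sum_filter_of_ne]
    intro t _ h h0
    exact h (by rw [h0, smul_zero])
  -- Lagrange polynomials on `s` recover each component as `P i (L_x) e`. Since `P i * P j` takes
  -- the values of `P i` or `0` on `s`, multiplicativity makes the components orthogonal
  -- idempotents.
  let P : s → ℝ[X] := fun i => Lagrange.basis Finset.univ (fun i : s => (i : ℝ)) i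
  have hinj : Set.InjOn (fun i : s => (i : ℝ)) (Finset.univ : Finset s) :=
    Subtype.val_injective.injOn
  have hP : ∀ i j : s, (P i).eval (j : ℝ) = if i = j then 1 else 0 := by
    intro i j
    split_ifs with h
    · subst h
      exact Lagrange.eval_basis_self hinj (Finset.mem_univ _)
    · exact Lagrange.eval_basis_of_ne h (Finset.mem_univ _)
  have hPd : ∀ i : s, aeval (J.mul x) (P i) J.one = d i := by
    intro i
    rw [hs]
    simp [hP]
  have hmul : ∀ i j : s, J.mul (d i) (d j) = if i = j then d i else 0 := by
    intro i j
    rw [← hPd i, ← hPd j, mul_aeval, hs]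
    simp only [eval_mul, hP, ite_mul, _root_.one_mul, zero_mul, ite_smul, one_smul, zero_smul,
      Finset.sum_ite_eq, Finset.mem_univ, if_true, hs, eq_comm (a := j)]
  refine ⟨s, fun i => d i, ⟨fun i => ?_, fun i => (Finset.mem_filter.mp i.2).2,
    fun i j h => ?_, ?_⟩, hs⟩
  · simp [IsIdempotent, hmul]
  · simp [hmul, h]
  · simpa using (hs 1).symm

namespace IsOrthogonalSystem

variable {J} {ι : Type*} [Fintype ι] {c : ι → E}

theorem mul_sum (hc : J.IsOrthogonalSystem c) (a b : ι → ℝ) :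
    J.mul (∑ i, a i • c i) (∑ i, b i • c i) = ∑ i, (a i * b i) • c i := by
  classical
  have h : ∀ i j, J.mul (c i) (c j) = if i = j then c i else 0 := by
    intro i j
    split_ifs with hij
    · subst hij; exact hc.idem i
    · exact hc.ortho i j hij
  simp [map_sum, h, smul_smul, _root_.mul_comm]

theorem pow_sum (hc : J.IsOrthogonalSystem c) (a : ι → ℝ) (n : ℕ) :
    J.pow (∑ i, a i • c i) n = ∑ i, (a i ^ n) • c i := by
  induction n with
  | zero => simp [pow_zero, hc.sum]
  | succ n ih => simp only [pow_succ, ih, hc.mul_sum, pow_succ']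

theorem inner_eq_zero (hc : J.IsOrthogonalSystem c) {i j : ι} (h : i ≠ j) :
    inner ℝ (c i) (c j) = 0 := by
  rw [← hc.idem i, J.inner_mul, hc.ortho i j h, inner_zero_right]

theorem linearIndependent (hc : J.IsOrthogonalSystem c) : LinearIndependent ℝ c :=
  linearIndependent_of_ne_zero_of_inner_eq_zero hc.ne_zero fun _ _ => hc.inner_eq_zero

end IsOrthogonalSystem

/-! ### Orthogonality of the summands of an idempotent -/

/-- `L_a` is symmetric with eigenvalues among `0, 1/2, 1`, where `λ = (λ(2λ - 1))² + 8(λ(1 - λ))²`.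
-/
theorem inner_idem_mul {a : E} (ha : J.IsIdempotent a) (x : E) :
    inner ℝ (J.mul a x) x = ‖J.mul a ((2 : ℝ) • J.mul a x - x)‖ ^ 2 +
      8 * ‖J.mul a (x - J.mul a x)‖ ^ 2 := by
  -- The linearized identity at `x = y = a` gives `2T³ - 3T² + T = 0` for `T = L_a`.
  have hc : ∀ y, J.mul a (J.mul a (J.mul a y)) =
      (3 / 2 : ℝ) • J.mul a (J.mul a y) - (1 / 2 : ℝ) • J.mul a y := by
    intro y
    have h := J.jordan_linearized a a y
    have ha' : J.mul a a = a := ha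
    rw [ha', ha'] at h
    linear_combination (norm := module) (1 / 2 : ℝ) • h
  have hs : ∀ y z, inner ℝ (J.mul a y) z = inner ℝ y (J.mul a z) := J.isSymmetric_mul a
  have h1 := hs x (J.mul a (J.mul a x))
  have h2 := hs (J.mul a x) (J.mul a (J.mul a x))
  rw [hc, inner_sub_right, real_inner_smul_right, real_inner_smul_right] at h1 h2
  have h3 := hs x (J.mul a x)
  rw [map_sub, map_sub, map_smul, norm_sub_sq_real, norm_sub_sq_real, norm_smul, mul_pow,
    real_inner_smul_left, Real.norm_ofNat,
    real_inner_comm (J.mul a x) (J.mul a (J.mul a x)), real_inner_comm x]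
  rw [real_inner_self_eq_norm_sq] at h2 h3
  rw [real_inner_self_eq_norm_sq] at h2
  linarith

theorem inner_idem_mul_nonneg {a : E} (ha : J.IsIdempotent a) (x : E) :
    0 ≤ inner ℝ (J.mul a x) x := by
  rw [J.inner_idem_mul ha]
  positivity

theorem idem_mul_eq_zero {a x : E} (ha : J.IsIdempotent a) (h : inner ℝ (J.mul a x) x ≤ 0) :
    J.mul a x = 0 := by
  rw [J.inner_idem_mul ha] at h
  have h1 : J.mul a ((2 : ℝ) • J.mul a x - x) = 0 := by
    rw [← norm_eq_zero, ← sq_eq_zero_iff]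
    exact le_antisymm (by nlinarith [sq_nonneg ‖J.mul a (x - J.mul a x)‖]) (sq_nonneg _)
  have h2 : J.mul a (x - J.mul a x) = 0 := by
    rw [← norm_eq_zero, ← sq_eq_zero_iff]
    exact le_antisymm (by nlinarith [sq_nonneg ‖J.mul a ((2 : ℝ) • J.mul a x - x)‖])
      (sq_nonneg _)
  rw [map_sub, map_smul] at h1
  rw [map_sub] at h2
  -- `λ(2λ - 1) + 2λ(1 - λ) = λ`.
  linear_combination (norm := module) h1 + (2 : ℝ) • h2

/-- The summands of an idempotent `a + b` are orthogonal to every element that is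
orthogonal to `a + b`. -/
theorem mul_eq_zero_of_add {a b d : E} (ha : J.IsIdempotent a) (hb : J.IsIdempotent b)
    (h : J.mul (a + b) d = 0) : J.mul a d = 0 := by
  refine J.idem_mul_eq_zero ha ?_
  have h1 := J.inner_idem_mul_nonneg hb d
  have h2 : inner ℝ (J.mul a d) d + inner ℝ (J.mul b d) d = 0 := by
    rw [← inner_add_left, ← LinearMap.add_apply, ← map_add, h, inner_zero_left]
  linarith

theorem mul_eq_zero_of_isIdempotent_add {a b : E} (ha : J.IsIdempotent a)
    (hb : J.IsIdempotent b) (h : J.IsIdempotent (a + b)) : J.mul a b = 0 := by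
  unfold IsIdempotent at *
  simp only [map_add, LinearMap.add_apply, ha, hb, J.mul_comm b a] at h
  linear_combination (norm := module) (1 / 2 : ℝ) • h

/-! ### The rank -/

/-- Keeps the `sInf` in `degree` from being that of an empty set, and bounds the supremum in `rank`.
-/
theorem finrank_mem_degree_set (x : E) :
    Module.finrank ℝ E ∈ {k | ¬ LinearIndependent ℝ (fun i : Fin (k + 1) => J.pow x i)} := by
  intro h
  simpa using h.fintype_card_le_finrank

theorem degree_le_finrank (x : E) : J.degree x ≤ Module.finrank ℝ E :=
  Nat.sInf_le (J.finrank_mem_degree_set x)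

theorem degree_le_rank (x : E) : J.degree x ≤ J.rank :=
  le_ciSup (f := J.degree) ⟨_, Set.forall_mem_range.mpr J.degree_le_finrank⟩ x

theorem linearIndependent_pow_of_le {x : E} {k l : ℕ} (hkl : k ≤ l)
    (h : LinearIndependent ℝ (fun i : Fin l => J.pow x i)) :
    LinearIndependent ℝ (fun i : Fin k => J.pow x i) :=
  h.comp (Fin.castLE hkl) (Fin.castLE_injective hkl)

theorem le_rank_of_linearIndependent {x : E} {k : ℕ}
    (h : LinearIndependent ℝ (fun i : Fin k => J.pow x i)) : k ≤ J.rank := by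
  refine le_trans ?_ (J.degree_le_rank x)
  by_contra! hlt
  exact Nat.sInf_mem ⟨_, J.finrank_mem_degree_set x⟩ (J.linearIndependent_pow_of_le hlt h)

theorem exists_linearIndependent_pow :
    ∃ x, LinearIndependent ℝ (fun i : Fin J.rank => J.pow x i) := by
  obtain ⟨x, hx⟩ := Nat.sSup_mem (Set.range_nonempty J.degree)
    ⟨_, Set.forall_mem_range.mpr J.degree_le_finrank⟩
  change J.degree x = J.rank at hx
  refine ⟨x, ?_⟩
  rw [← hx]
  -- Independence of `k + 1` powers follows from minimality at `k`, one below the degree, so degree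
  -- zero is separate.
  rcases Nat.eq_zero_or_pos (J.degree x) with h0 | hpos
  · have : IsEmpty (Fin (J.degree x)) := by rw [h0]; infer_instance
    exact linearIndependent_empty_type
  · obtain ⟨k, hk⟩ := Nat.exists_eq_succ_of_ne_zero hpos.ne'
    rw [hk]
    exact not_not.mp (Nat.notMem_of_lt_sInf (show k < J.degree x by omega))

/-- A combination with distinct coefficients `0, …, n - 1` has `n` independent powers, by
Vandermonde. -/
theorem IsOrthogonalSystem.card_le_rank {J : EuclideanJordanAlgebra E} {ι : Type*} [Fintype ι]
    {c : ι → E} (hc : J.IsOrthogonalSystem c) : Fintype.card ι ≤ J.rank := by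
  set n := Fintype.card ι
  let f : ι ≃ Fin n := Fintype.equivFin ι
  refine J.le_rank_of_linearIndependent (x := ∑ i, ((f i : ℕ) : ℝ) • c i) ?_
  rw [Fintype.linearIndependent_iff]
  intro g hg
  simp only [hc.pow_sum, Finset.smul_sum, smul_smul] at hg
  rw [Finset.sum_comm] at hg
  simp only [← Finset.sum_smul] at hg
  have h := Fintype.linearIndependent_iff.mp hc.linearIndependent _ hg
  refine congrFun (Matrix.eq_zero_of_forall_index_sum_pow_mul_eq_zero
    (f := fun j : Fin n => ((j : ℕ) : ℝ)) (v := g)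
    (fun a b hab => Fin.ext (Nat.cast_injective hab)) fun j => ?_)
  have := h (f.symm j)
  simpa [_root_.mul_comm] using this

/-- An element whose powers span a space of dimension at least the rank is a combination of as
many orthogonal idempotents as the rank. -/
theorem exists_orthogonalSystem_of_linearIndependent {x : E}
    (hx : LinearIndependent ℝ (fun i : Fin J.rank => J.pow x i)) :
    ∃ c : Fin J.rank → E, J.IsOrthogonalSystem c ∧ ∃ a : Fin J.rank → ℝ, x = ∑ i, a i • c i := by
  obtain ⟨s, c, hc, h⟩ := J.exists_spectral x
  have hle : J.rank ≤ Fintype.card s := by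
    have hspan : Set.range (fun i : Fin J.rank => J.pow x i) ≤
        Submodule.span ℝ (Set.range c) := by
      rintro _ ⟨k, rfl⟩
      have hk := h (Polynomial.X ^ (k : ℕ))
      simp only [map_pow, Polynomial.aeval_X, ← pow_eq] at hk
      simp only [hk]
      exact Submodule.sum_mem _ fun i _ => Submodule.smul_mem _ _
        (Submodule.subset_span (Set.mem_range_self i))
    classical
    have := linearIndependent_le_span_aux' _ hx (Set.range c) hspan
    refine le_trans (by simpa using this) (Fintype.card_range_le c)
  have hcard : Fintype.card s = J.rank := le_antisymm hc.card_le_rank hle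
  let f : Fin J.rank ≃ s := (Fintype.equivFinOfCardEq hcard).symm
  refine ⟨c ∘ f, ⟨fun i => hc.idem _, fun i => hc.ne_zero _,
    fun i j hij => hc.ortho _ _ (f.injective.ne hij), ?_⟩, fun i => (f i : ℝ), ?_⟩
  · rw [← hc.sum]
    exact f.sum_comp c
  · have hX := h Polynomial.X
    simp only [Polynomial.aeval_X, J.mul_one, Polynomial.eval_X] at hX
    rw [hX]
    exact (f.sum_comp fun i : s => (i : ℝ) • c i).symm

/-- A complete system of nonzero orthogonal idempotents with as many members as the rank is a
Jordan frame. -/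
theorem IsOrthogonalSystem.mem_frames {J : EuclideanJordanAlgebra E} {c : Fin J.rank → E}
    (hc : J.IsOrthogonalSystem c) : c ∈ J.frames := by
  refine ⟨fun i => ⟨hc.idem i, hc.ne_zero i, ?_⟩, hc.ortho, hc.sum⟩
  rintro ⟨a, b, ha, hb, ha0, hb0, hab⟩
  have hi : J.IsIdempotent (a + b) := hab ▸ hc.idem i
  have hmul : ∀ j, j ≠ i → J.mul a (c j) = 0 := fun j hj =>
    J.mul_eq_zero_of_add ha hb (hab ▸ hc.ortho i j hj.symm)
  have hmul' : ∀ j, j ≠ i → J.mul b (c j) = 0 := fun j hj =>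
    J.mul_eq_zero_of_add hb ha (by rw [add_comm, ← hab]; exact hc.ortho i j hj.symm)
  have hab' := J.mul_eq_zero_of_isIdempotent_add ha hb hi
  -- Replacing `c i` by `a` and adjoining `b` yields a system of `rk + 1` idempotents, which is too
  -- many.
  have key : J.IsOrthogonalSystem (fun o : Option (Fin J.rank) =>
      o.elim b (Function.update c i a)) := by
    refine ⟨?_, ?_, ?_, ?_⟩
    · rintro (_ | j)
      · exact hb
      · by_cases hj : j = i
        · subst hj; simpa using ha
        · simpa [hj] using hc.idem j
    · rintro (_ | j)
      · exact hb0
      · by_cases hj : j = i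
        · subst hj; simpa using ha0
        · simpa [hj] using hc.ne_zero j
    · have h1 : ∀ j, J.mul b (Function.update c i a j) = 0 := by
        intro j
        by_cases hj : j = i
        · subst hj; simpa [J.mul_comm b] using hab'
        · simpa [hj] using hmul' j hj
      rintro (_ | j) (_ | k) hjk
      · exact absurd rfl hjk
      · exact h1 k
      · exact (J.mul_comm _ _).trans (h1 j)
      · have hjk' : j ≠ k := fun h => hjk (by rw [h])
        by_cases hj : j = i
        · subst hj; simpa [hjk'.symm] using hmul k hjk'.symm
        · by_cases hk : k = i
          · subst hk; simpa [hj, J.mul_comm _ a] using hmul j hj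
          · simpa [hj, hk] using hc.ortho j k hjk'
    · rw [Fintype.sum_option, ← hc.sum, ← Finset.add_sum_erase _ c (Finset.mem_univ i),
        ← Finset.add_sum_erase _ _ (Finset.mem_univ i)]
      simp only [Option.elim_none, Option.elim_some, Function.update_self]
      rw [Finset.sum_congr rfl fun j hj =>
        Function.update_of_ne (Finset.ne_of_mem_erase hj) a c, hab]
      abel
  have := key.card_le_rank
  simp at this

theorem isOrthogonalSystem_of_mem_frames {c : Fin J.rank → E} (hc : c ∈ J.frames) :
    J.IsOrthogonalSystem c :=
  ⟨fun i => (hc.1 i).1, fun i => (hc.1 i).2.1, hc.2.1, hc.2.2⟩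

end EuclideanJordanAlgebra

/-! ### Density of the regular elements and compactness of the Jordan frames -/

namespace EuclideanJordanAlgebra

variable {E : Type*} [NormedAddCommGroup E] [InnerProductSpace ℝ E] [FiniteDimensional ℝ E]
  (J : EuclideanJordanAlgebra E)

theorem exists_norm_mul_le : ∃ M : ℝ, ∀ x y, ‖J.mul x y‖ ≤ M * ‖x‖ * ‖y‖ :=
  ⟨_, J.mul.toContinuousBilinearMap.le_opNorm₂⟩

theorem continuous_mul {X : Type*} [TopologicalSpace X] {f g : X → E} (hf : Continuous f)
    (hg : Continuous g) : Continuous fun t => J.mul (f t) (g t) :=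
  J.mul.toContinuousBilinearMap.continuous₂.comp (hf.prodMk hg)

theorem analyticAt_mul {f g : ℝ → E} {t : ℝ} (hf : AnalyticAt ℝ f t) (hg : AnalyticAt ℝ g t) :
    AnalyticAt ℝ (fun t => J.mul (f t) (g t)) t :=
  (J.mul.toContinuousBilinearMap.analyticAt_bilinear (f t, g t)).comp₂ hf hg

theorem analyticAt_pow {f : ℝ → E} {t : ℝ} (hf : AnalyticAt ℝ f t) (n : ℕ) :
    AnalyticAt ℝ (fun t => J.pow (f t) n) t := by
  induction n with
  | zero => exact analyticAt_const
  | succ n ih => exact J.analyticAt_mul hf ih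

/-- On the line from `x` to an element `y` with independent powers, the Gram determinant of the
powers is analytic and nonzero at `y`, hence nonzero at all points near `x` other than `x` itself.
-/
theorem dense_linearIndependent_pow :
    Dense {x | LinearIndependent ℝ (fun i : Fin J.rank => J.pow x i)} := by
  intro x
  obtain ⟨y, hy⟩ := J.exists_linearIndependent_pow
  let f : ℝ → E := fun t => x + t • (y - x)
  have hf : ∀ t, AnalyticAt ℝ f t := fun t => by fun_prop
  let G : ℝ → ℝ := fun t => (Matrix.gram ℝ fun i : Fin J.rank => J.pow (f t) i).det
  have hG : AnalyticOnNhd ℝ G Set.univ := by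
    intro t _
    have hinner : ∀ i j : ℕ, AnalyticAt ℝ
        (fun t => (inner ℝ (J.pow (f t) i) (J.pow (f t) j) : ℝ)) t := fun i j =>
      ((innerSL ℝ (E := E)).analyticAt_bilinear (J.pow (f t) i, J.pow (f t) j)).comp₂
        (J.analyticAt_pow (hf t) i) (J.analyticAt_pow (hf t) j)
    simp only [G, Matrix.det_apply, Matrix.gram_apply]
    refine Finset.analyticAt_fun_sum _ fun σ _ => ?_
    simp only [Units.smul_def, zsmul_eq_mul]
    exact analyticAt_const.mul (Finset.analyticAt_fun_prod _ fun i _ => hinner _ _)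
  have hG1 : G 1 ≠ 0 := by
    refine Matrix.det_gram_ne_zero_iff_linearIndependent.mpr ?_
    simpa [f] using hy
  have hne : ∀ᶠ t in nhdsWithin (0 : ℝ) {0}ᶜ, G t ≠ 0 := by
    by_contra h
    exact hG1 (hG.eqOn_zero_of_preconnected_of_frequently_eq_zero isPreconnected_univ
      (Set.mem_univ 0) (fun h' => h (h'.mono fun _ => id)) (Set.mem_univ 1))
  have hlim : Filter.Tendsto f (nhdsWithin 0 {0}ᶜ) (nhds x) := by
    have := (hf 0).continuousAt.tendsto
    simp only [f, zero_smul, add_zero] at this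
    exact this.mono_left nhdsWithin_le_nhds
  exact mem_closure_of_tendsto hlim
    (hne.mono fun t ht => Matrix.det_gram_ne_zero_iff_linearIndependent.mp ht)

theorem isCompact_orthogonalSystem (ι : Type*) [Fintype ι] :
    IsCompact {c : ι → E | J.IsOrthogonalSystem c} := by
  obtain ⟨M, hM⟩ := J.exists_norm_mul_le
  -- The open condition `c i ≠ 0` becomes a closed one: `‖c‖ = ‖c ∘ c‖ ≤ M‖c‖²` gives `1 ≤ M‖c‖` for
  -- a nonzero idempotent.
  have hset : {c : ι → E | J.IsOrthogonalSystem c} =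
      {c | ∀ i, J.mul (c i) (c i) = c i} ∩ {c | ∀ i, 1 ≤ M * ‖c i‖} ∩
        {c | ∀ i j, i ≠ j → J.mul (c i) (c j) = 0} ∩ {c | ∑ i, c i = J.one} := by
    ext c
    refine ⟨fun h => ⟨⟨⟨h.idem, fun i => ?_⟩, h.ortho⟩, h.sum⟩,
      fun h => ⟨h.1.1.1, fun i h0 => ?_, h.1.2, h.2⟩⟩
    · have h1 := hM (c i) (c i)
      rw [h.idem i] at h1
      have h2 := norm_pos_iff.mpr (h.ne_zero i)
      exact le_of_mul_le_mul_right (by linarith) h2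
    · have := h.1.1.2 i
      rw [h0, norm_zero, mul_zero] at this
      exact absurd this (by norm_num)
  refine Metric.isCompact_of_isClosed_isBounded ?_ ?_
  · rw [hset]
    refine ((IsClosed.inter ?_ ?_).inter ?_).inter ?_
    · simp only [Set.ofPred_forall]
      exact isClosed_iInter fun i => isClosed_eq
        (J.continuous_mul (continuous_apply i) (continuous_apply i)) (continuous_apply i)
    · simp only [Set.ofPred_forall]
      exact isClosed_iInter fun i => isClosed_le continuous_const
        (continuous_const.mul (continuous_apply i).norm)
    · simp only [Set.ofPred_forall]
      exact isClosed_iInter fun i => isClosed_iInter fun j => isClosed_iInter fun _ => isClosed_eq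
        (J.continuous_mul (continuous_apply i) (continuous_apply j)) continuous_const
    · exact isClosed_eq (continuous_finsetSum _ fun i _ => continuous_apply i) continuous_const
  · refine (Metric.isBounded_iff_subset_closedBall 0).mpr ⟨‖J.one‖, fun c hc => ?_⟩
    rw [mem_closedBall_zero_iff, pi_norm_le_iff_of_nonneg (norm_nonneg _)]
    intro i
    have h1 : ‖c i‖ ^ 2 = inner ℝ (c i) J.one := by
      conv_rhs => rw [← hc.idem i, J.inner_mul, J.mul_one]
      exact (real_inner_self_eq_norm_sq _).symm
    have h2 := real_inner_le_norm (c i) J.one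
    have h3 := norm_pos_iff.mpr (hc.ne_zero i)
    exact le_of_mul_le_mul_left (by nlinarith) h3

/-- The coefficients are unbounded, but orthogonality recovers them from `x` and `c`. The condition
becomes a closed relation between `x` and `c`, and projection along the compact space of systems is
a closed map. -/
theorem isClosed_combinations (ι : Type*) [Fintype ι] :
    IsClosed {x | ∃ c : ι → E, J.IsOrthogonalSystem c ∧ ∃ a : ι → ℝ, x = ∑ i, a i • c i} := by
  have : CompactSpace {c : ι → E | J.IsOrthogonalSystem c} :=
    isCompact_iff_compactSpace.mp (J.isCompact_orthogonalSystem ι)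
  let g : E × {c : ι → E | J.IsOrthogonalSystem c} → E := fun p =>
    ∑ i, (inner ℝ p.1 (p.2.1 i) / inner ℝ (p.2.1 i) (p.2.1 i)) • p.2.1 i
  have hg : Continuous g := by
    have hi : ∀ i, Continuous fun p : E × {c : ι → E | J.IsOrthogonalSystem c} => p.2.1 i :=
      fun i => (continuous_apply i).comp (continuous_subtype_val.comp continuous_snd)
    refine continuous_finsetSum _ fun i _ => Continuous.smul (Continuous.div
      (continuous_fst.inner (hi i)) ((hi i).inner (hi i)) fun p => ?_) (hi i)
    exact inner_self_ne_zero.mpr (p.2.2.ne_zero i)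
  convert isClosedMap_fst_of_compactSpace _ (isClosed_eq continuous_fst hg) using 1
  ext x
  constructor
  · rintro ⟨c, hc, a, hx⟩
    refine ⟨(x, ⟨c, hc⟩), ?_, rfl⟩
    change x = ∑ i, (inner ℝ x (c i) / inner ℝ (c i) (c i)) • c i
    conv_lhs => rw [hx]
    refine Finset.sum_congr rfl fun i _ => ?_
    congr 1
    rw [eq_div_iff (inner_self_ne_zero.mpr (hc.ne_zero i)), hx, sum_inner,
      Finset.sum_eq_single_of_mem i (Finset.mem_univ i), real_inner_smul_left]
    intro j _ hj
    rw [real_inner_smul_left, hc.inner_eq_zero hj, mul_zero]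
  · rintro ⟨⟨y, c, hc⟩, hy, rfl⟩
    exact ⟨c, hc, _, hy⟩

/-- The spectral theorem: every element is a combination of the members of a Jordan frame. -/
theorem exists_frame_decomposition (x : E) :
    ∃ c ∈ J.frames, ∃ a : Fin J.rank → ℝ, x = ∑ i, a i • c i := by
  have h : x ∈ {x | ∃ c : Fin J.rank → E, J.IsOrthogonalSystem c ∧
      ∃ a : Fin J.rank → ℝ, x = ∑ i, a i • c i} := by
    rw [← (J.isClosed_combinations (Fin J.rank)).closure_eq]
    exact closure_mono (fun y hy => J.exists_orthogonalSystem_of_linearIndependent hy)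
      (J.dense_linearIndependent_pow x)
  obtain ⟨c, hc, a, hx⟩ := h
  exact ⟨c, hc.mem_frames, a, hx⟩

end EuclideanJordanAlgebra

/-! ### Evaluation of symmetric tensors -/

section Evaluation

variable {E : Type*} [NormedAddCommGroup E] [InnerProductSpace ℝ E] [FiniteDimensional ℝ E]
  {m k : ℕ}

theorem TensorPow.pure_sum {V : Type*} [AddCommGroup V] [Module ℝ V] (x : Fin k → ℝ)
    (c : Fin k → V) : (TensorPow.pure fun _ : Fin m => ∑ j, x j • c j) =
      ∑ i : Fin m → Fin k, (∏ l, x (i l)) • TensorPow.pure fun l => c (i l) := by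
  have h := (PiTensorProduct.tprod ℝ : MultilinearMap ℝ (fun _ : Fin m => V) _).map_sum
    (fun (_ : Fin m) (j : Fin k) => x j • c j)
  simp only [MultilinearMap.map_smul_univ] at h
  exact h

/-- The evaluation at a system of vectors as a linear map. -/
noncomputable def evalAtLinear (m : ℕ) (c : Fin k → E) :
    symTensor E m →ₗ[ℝ] symTensor (EuclideanSpace ℝ (Fin k)) m where
  toFun A := evalAt A c
  map_add' A B := Subtype.ext <| by
    simp [evalAt, inner_add_left, add_smul, Finset.sum_add_distrib]
  map_smul' a A := Subtype.ext <| by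
    simp [evalAt, real_inner_smul_left, mul_smul, Finset.smul_sum]

/-- Both sides expand to the sum over `i` of `⟨A, c i₁ ⊗ ⋯ ⊗ c iₘ⟩ ∏ x (i l)`. -/
theorem inner_evalAt (A : symTensor E m) (c : Fin k → E) (x : EuclideanSpace ℝ (Fin k)) :
    inner ℝ (evalAt A c : TensorPow (EuclideanSpace ℝ (Fin k)) m) (TensorPow.pure fun _ => x) =
      inner ℝ (A : TensorPow E m) (TensorPow.pure fun _ => ∑ j, x j • c j) := by
  rw [TensorPow.pure_sum, inner_sum]
  simp only [evalAt, sum_inner, real_inner_smul_left, real_inner_smul_right,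
    TensorPow.inner_pure]
  refine Finset.sum_congr rfl fun i _ => ?_
  simp [mul_comm, EuclideanSpace.inner_single_left]

/-- Only positive scalars are allowed, so `0` arises as the limit of `t • x` as `t → 0⁺`. -/
theorem IsClosedConvexCone.zero_mem {X : Type*} [NormedAddCommGroup X] [NormedSpace ℝ X]
    {K : Set X} (hK : IsClosedConvexCone K) : 0 ∈ K := by
  obtain ⟨x, hx⟩ := hK.nonempty
  have hlim : Filter.Tendsto (fun t : ℝ => t • x) (nhdsWithin 0 (Set.Ioi 0)) (nhds 0) := by
    have h : Continuous fun t : ℝ => t • x := by fun_prop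
    simpa using (h.tendsto 0).mono_left nhdsWithin_le_nhds
  exact hK.closed.mem_of_tendsto hlim
    (Filter.eventually_of_mem self_mem_nhdsWithin fun t ht => hK.smul_mem t ht x hx)

theorem isClosedConvexCone_frameCone {F : Set (Fin k → E)}
    {K : Set (symTensor (EuclideanSpace ℝ (Fin k)) m)} (hK : IsClosedConvexCone K) :
    IsClosedConvexCone (frameCone F K) := by
  have h : frameCone F K = ⋂ c ∈ F, evalAtLinear m c ⁻¹' K := rfl
  rw [h]
  refine ⟨⟨0, ?_⟩, fun a ha A hA => ?_, ?_, ?_⟩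
  · refine Set.mem_iInter₂.mpr fun c _ => ?_
    rw [Set.mem_preimage, map_zero]
    exact hK.zero_mem
  · refine Set.mem_iInter₂.mpr fun c hc => ?_
    rw [Set.mem_preimage, map_smul]
    exact hK.smul_mem a ha _ (Set.mem_iInter₂.mp hA c hc)
  · exact convex_iInter₂ fun c _ => hK.convex.linear_preimage _
  · exact isClosed_biInter fun c _ =>
      hK.closed.preimage (evalAtLinear m c).continuous_of_finiteDimensional

theorem frameCone_iInter (F : Set (Fin k → E))
    (K : ℕ → Set (symTensor (EuclideanSpace ℝ (Fin k)) m)) :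
    frameCone F (⋂ r, K r) = ⋂ r, frameCone F (K r) := by
  ext A
  simp only [frameCone, Set.mem_iInter, Set.mem_ofPred_eq]
  exact ⟨fun h r c hc => h c hc r, fun h c hc r => h r c hc⟩

/-- A symmetric tensor is copositive over the symmetric cone if and only if its evaluations at
enough Jordan frames are copositive. -/
theorem copCone_symmetricCone (J : EuclideanJordanAlgebra E) (m : ℕ)
    {Fc F : Set (Fin J.rank → E)} (hFc : J.IsFrameTransversal Fc) (hFcF : Fc ⊆ F)
    (hF : F ⊆ J.frames) :
    copCone m J.symmetricCone = frameCone F (copCone m (nonnegOrthant J.rank)) := by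
  ext A
  simp only [frameCone, Set.mem_iInter]
  constructor
  · intro hA c hc x hx
    rw [inner_evalAt]
    refine hA _ ⟨∑ i, Real.sqrt (x i) • c i, ?_⟩
    rw [(J.isOrthogonalSystem_of_mem_frames (hF hc)).mul_sum]
    exact Finset.sum_congr rfl fun i _ => by rw [Real.mul_self_sqrt (hx i)]
  · rintro hA _ ⟨y, rfl⟩
    obtain ⟨c, hc, a, rfl⟩ := J.exists_frame_decomposition y
    -- The frame of `y` need not lie in `F`, but a reordering `d` does; the squared coefficients are
    -- permuted along.
    obtain ⟨d, ⟨hd, σ, hσ⟩, -⟩ := hFc.2 c hc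
    have h := hA d (hFcF hd) (WithLp.toLp 2 fun i => a (σ i) * a (σ i))
      fun i => mul_self_nonneg (a (σ i))
    rw [inner_evalAt] at h
    rw [(J.isOrthogonalSystem_of_mem_frames hc).mul_sum, ← Equiv.sum_comp σ]
    simpa only [hσ] using h

end Evaluation

theorem mainTheorem4 {E : Type*} [NormedAddCommGroup E] [InnerProductSpace ℝ E]
    [FiniteDimensional ℝ E] (J : EuclideanJordanAlgebra E) (m : ℕ)
    (O : ℕ → Set (symTensor (EuclideanSpace ℝ (Fin J.rank)) m))
    (hO : ∀ r, IsClosedConvexCone (O r))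
    (hdec : DecreasesTo O (copCone m (nonnegOrthant J.rank)))
    (Fc F : Set (Fin J.rank → E)) (hFc : J.IsFrameTransversal Fc)
    (hFcF : Fc ⊆ F) (hF : F ⊆ J.frames) :
    (∀ r, IsClosedConvexCone (frameCone F (O r))) ∧
      DecreasesTo (fun r => frameCone F (O r)) (copCone m J.symmetricCone) := by
  refine ⟨fun r => isClosedConvexCone_frameCone (hO r), fun r => ?_, ?_⟩
  · exact Set.iInter₂_mono fun c _ => fun A hA => hdec.1 r hA
  · rw [copCone_symmetricCone J m hFc hFcF hF, hdec.2, frameCone_iInter]
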